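/- Let $d\ge 3$ and let $p\in\mathbb{C}[z]$ be a monic polynomial of degree $d$ with pairwise distinct roots. One step of the Gauss–Seidel variant of the Weierstrass method for $p$ takes $(z_1,\dots,z_d)\in\mathbb{C}^d$ and, for $i=1,\dots,d$ in this order, replaces $z_i$ by $$z_i-\frac{p(z_i)}{\prod_{j\ne i}(z_i-z_j)},$$ where each replacement uses the current (already updated) values of the other coordinates; the step is well defined if none of these $d$ denominators vanishes. Then this method has orbits in $\mathbb{C}^d$ that diverge to infinity: there is a sequence $(z^{(m)})_{m\ge 0}$ in $\mathbb{C}^d$ such that for every $m$ the step is well defined at $z^{(m)}$ and sends it to $z^{(m+1)}$, and $\|z^{(m)}\|\to\infty$ as $m\to\infty$. -/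

import Mathlib

open Polynomial Filter

noncomputable section

/-- The Weierstrass update of the `i`-th coordinate,
`z_i - p(z_i) / ∏_{j ≠ i} (z_i - z_j)`. -/
def weierstrassUpdate {n : ℕ} (p : ℂ[X]) (z : Fin n → ℂ) (i : Fin n) : ℂ :=
  z i - p.eval (z i) / ∏ j ∈ Finset.univ.erase i, (z i - z j)

/-- The approximation vector after the first `k` passes of the Gauss–Seidel loop:
coordinates `0, …, k - 1` have been replaced, one after the other, each update using
the current values of all the other coordinates. -/
def gswPartial {n : ℕ} (p : ℂ[X]) (z : Fin n → ℂ) : ℕ → Fin n → ℂ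
  | 0 => z
  | k + 1 =>
    if h : k < n then
      Function.update (gswPartial p z k) ⟨k, h⟩ (weierstrassUpdate p (gswPartial p z k) ⟨k, h⟩)
    else gswPartial p z k

/-- One full step of the Gauss–Seidel variant of the Weierstrass method. -/
def GSW {n : ℕ} (p : ℂ[X]) (z : Fin n → ℂ) : Fin n → ℂ :=
  gswPartial p z n

/-- The Gauss–Seidel step at `z` is well defined: no denominator vanishes in any of
its `n` successive coordinate updates. -/
def GSWDefinedAt {n : ℕ} (p : ℂ[X]) (z : Fin n → ℂ) : Prop :=
  ∀ i : Fin n, ∏ j ∈ Finset.univ.erase i, (gswPartial p z i i - gswPartial p z i j) ≠ 0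

/-- `z` is an infinite forward orbit in `ℂⁿ` of the Gauss–Seidel Weierstrass method for `p`. -/
def IsGSWOrbit {n : ℕ} (p : ℂ[X]) (z : ℕ → Fin n → ℂ) : Prop :=
  ∀ m : ℕ, GSWDefinedAt p (z m) ∧ z (m + 1) = GSW p (z m)

end

/- List the values taken successively by all coordinates in one sequence `y`; the method then reads
`∏_{j = 1}^d (y_k - y_{k + j}) = p(y_k)`. To leading order at infinity this is solved by
`y_k = ε⁻¹ μ ^ k`, provided that `∏_{j = 1}^d (1 - μ ^ j)` is the leading coefficient `b` of `p`.
There is such a `μ` with `|μ| > 1`: otherwise `f(x) = ∏_{j = 1}^d (1 - x ^ j) - b`, having all its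
roots in the closed unit disc, would satisfy `|f(x)| ≥ x ^ deg f |f(x⁻¹)|` for `x ≥ 1`, which near
`x = 1` is incompatible with the zero of order `d ≥ 2` and the reciprocity of the product.

The lower coefficients of `p` are corrected for by `y_k = ε⁻¹ μ ^ k (1 + ρ ^ k v_k)` with
`|μ|⁻¹ < ρ < 1` and `v` bounded, found for small `ε ≠ 0` by the implicit function theorem. The
linearization in `v` is a polynomial in `ρ` times the left shift, hence surjective as soon as `ρ`
avoids the moduli of its roots. Only surjectivity is needed, so resonances play no role. -/

open scoped Topology BoundedContinuousFunction

theorem mul_norm_inv_sub_le_norm_sub {x : ℝ} {a : ℂ} (hx : 1 ≤ x) (ha : ‖a‖ ≤ 1) :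
    x * ‖(x : ℂ)⁻¹ - a‖ ≤ ‖x - a‖ := by
  have hx0 : 0 < x := zero_lt_one.trans_le hx
  have hscale : x * ‖(x : ℂ)⁻¹ - a‖ = ‖1 - x * a‖ := by
    rw [← Complex.norm_of_nonneg hx0.le, ← norm_mul, Complex.norm_of_nonneg hx0.le, mul_sub,
      mul_inv_cancel₀ (Complex.ofReal_ne_zero.2 hx0.ne')]
  have hdiff : ‖x - a‖ ^ 2 - ‖1 - x * a‖ ^ 2 = (x ^ 2 - 1) * (1 - ‖a‖ ^ 2) := by
    simp only [Complex.sq_norm, Complex.normSq_apply, Complex.sub_re, Complex.sub_im,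
      Complex.mul_re, Complex.mul_im, Complex.ofReal_re, Complex.ofReal_im, Complex.one_re,
      Complex.one_im]
    ring
  have hnonneg : 0 ≤ (x ^ 2 - 1) * (1 - ‖a‖ ^ 2) :=
    mul_nonneg (sub_nonneg.2 (one_le_pow₀ hx)) (sub_nonneg.2 (pow_le_one₀ (norm_nonneg a) ha))
  rw [hscale]
  exact le_of_sq_le_sq (by linarith) (norm_nonneg _)

theorem pow_natDegree_mul_norm_eval_inv_le {f : ℂ[X]} (hf : ∀ a ∈ f.roots, ‖a‖ ≤ 1) {x : ℝ}
    (hx : 1 ≤ x) : x ^ f.natDegree * ‖f.eval (x : ℂ)⁻¹‖ ≤ ‖f.eval (x : ℂ)‖ := by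
  have hnorm (y : ℂ) :
      ‖f.eval y‖ = ‖f.leadingCoeff‖ * (f.roots.map fun a => ‖y - a‖).prod := by
    rw [(IsAlgClosed.splits f).eval_eq_prod_roots, norm_mul]
    exact congrArg _ (by simpa using map_multiset_prod (normHom : ℂ →*₀ ℝ) (f.roots.map (y - ·)))
  calc x ^ f.natDegree * ‖f.eval (x : ℂ)⁻¹‖
      = ‖f.leadingCoeff‖ * (f.roots.map fun a => x * ‖(x : ℂ)⁻¹ - a‖).prod := by
        rw [hnorm, Multiset.prod_map_mul, Multiset.map_const', Multiset.prod_replicate,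
          (IsAlgClosed.splits f).natDegree_eq_card_roots, mul_left_comm]
    _ ≤ ‖f.leadingCoeff‖ * (f.roots.map fun a => ‖(x : ℂ) - a‖).prod := by
        gcongr
        exact Multiset.prod_map_le_prod_map₀ _ _ (fun _ _ => by positivity)
          fun a ha => mul_norm_inv_sub_le_norm_sub hx (hf a ha)
    _ = ‖f.eval (x : ℂ)‖ := (hnorm x).symm

theorem exists_one_lt_norm_eval_eq {F : ℂ[X]} (hdeg : 0 < F.natDegree)
    (hrecip : ∀ x : ℂ, x ≠ 0 → ‖x ^ F.natDegree * F.eval x⁻¹‖ = ‖F.eval x‖)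
    (hdvd : (X - C 1) ^ 2 ∣ F) {b : ℂ} (hb : b ≠ 0) : ∃ μ : ℂ, 1 < ‖μ‖ ∧ F.eval μ = b := by
  by_contra! hno
  have hroots : ∀ a ∈ (F - C b).roots, ‖a‖ ≤ 1 := fun a ha => not_lt.1 fun h => hno a h <| by
    simpa [sub_eq_zero] using isRoot_of_mem_roots ha
  have hlower {x : ℝ} (hx : 1 < x) : ‖b‖ * (x - 1) ≤ 2 * ‖F.eval (x : ℂ)‖ := by
    have hx0 : 0 < x := zero_lt_one.trans hx
    have hrec := hrecip x (Complex.ofReal_ne_zero.2 hx0.ne')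
    rw [norm_mul, norm_pow, Complex.norm_of_nonneg hx0.le] at hrec
    have hpow : x ≤ x ^ F.natDegree := le_self_pow₀ hx.le hdeg.ne'
    have hF := pow_natDegree_mul_norm_eval_inv_le hroots hx.le
    simp only [natDegree_sub_C, eval_sub, eval_C] at hF
    have hinv : ‖b‖ - ‖F.eval (x : ℂ)⁻¹‖ ≤ ‖F.eval (x : ℂ)⁻¹ - b‖ := norm_sub_rev b _ ▸
      norm_sub_norm_le b _
    have htri := norm_sub_le (F.eval (x : ℂ)) b
    have hscaled := mul_le_mul_of_nonneg_left hinv (pow_nonneg hx0.le F.natDegree)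
    have hgrow := mul_le_mul_of_nonneg_left hpow (norm_nonneg b)
    linarith
  obtain ⟨G, rfl⟩ := hdvd
  have hbound : ∀ x : ℝ, 1 < x → ‖b‖ ≤ 2 * ((x - 1) * ‖G.eval (x : ℂ)‖) := fun x hx => by
    have hx1 : 0 < x - 1 := sub_pos.2 hx
    have hnorm : ‖(x : ℂ) - 1‖ = x - 1 := by
      rw [← Complex.ofReal_one, ← Complex.ofReal_sub, Complex.norm_of_nonneg hx1.le]
    have := hlower hx
    rw [eval_mul, eval_pow, eval_sub, eval_X, eval_C, norm_mul, norm_pow, hnorm] at this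
    refine le_of_mul_le_mul_right ?_ hx1
    linarith
  have hlim : Tendsto (fun x : ℝ => 2 * ((x - 1) * ‖G.eval (x : ℂ)‖)) (𝓝[>] 1) (𝓝 0) := by
    have hcont : Continuous fun x : ℝ => 2 * ((x - 1) * ‖G.eval (x : ℂ)‖) := by fun_prop
    simpa using (hcont.tendsto 1).mono_left nhdsWithin_le_nhds
  exact hb (norm_le_zero_iff.1
    (ge_of_tendsto hlim (eventually_nhdsWithin_of_forall hbound)))

/-- The `q`-Pochhammer symbol `(q; q)_d = (1 - q) (1 - q ^ 2) ⋯ (1 - q ^ d)`, as a polynomial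
in `q`. Its value at `μ` is the ratio of `∏_{j = 1}^d (y_k - y_{k + j})` to `y_k ^ d` along
`y_k = μ ^ k`. -/
noncomputable def qPochhammer (R : Type*) [CommRing R] (d : ℕ) : R[X] :=
  ∏ j ∈ Finset.range d, (1 - X ^ (j + 1))

theorem eval_qPochhammer {R : Type*} [CommRing R] (d : ℕ) (x : R) :
    (qPochhammer R d).eval x = ∏ j ∈ Finset.range d, (1 - x ^ (j + 1)) := by
  simp [qPochhammer, eval_prod]

theorem natDegree_qPochhammer (R : Type*) [CommRing R] [IsDomain R] (d : ℕ) :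
    (qPochhammer R d).natDegree = ∑ j ∈ Finset.range d, (j + 1) := by
  have hfactor (j : ℕ) : (1 - X ^ (j + 1) : R[X]).natDegree = j + 1 := by
    rw [← natDegree_neg, neg_sub]
    exact natDegree_X_pow_sub_C (r := (1 : R))
  rw [qPochhammer, natDegree_prod _ _ fun j _ h0 => by simpa [h0] using hfactor j]
  exact Finset.sum_congr rfl fun j _ => hfactor j

theorem X_sub_C_one_pow_dvd_qPochhammer (R : Type*) [CommRing R] (d : ℕ) :
    (X - C 1) ^ d ∣ qPochhammer R d := by
  calc (X - C 1 : R[X]) ^ d = ∏ _j ∈ Finset.range d, (X - C 1) := by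
        rw [Finset.prod_const, Finset.card_range]
    _ ∣ qPochhammer R d := Finset.prod_dvd_prod_of_dvd _ _ fun j _ => by
        rw [dvd_iff_isRoot, IsRoot.def]
        simp

theorem pow_natDegree_mul_eval_inv_qPochhammer {K : Type*} [Field K] (d : ℕ) {x : K} (hx : x ≠ 0) :
    x ^ (qPochhammer K d).natDegree * (qPochhammer K d).eval x⁻¹ =
      (-1) ^ d * (qPochhammer K d).eval x := by
  have hfactor (j : ℕ) : x ^ (j + 1) * (1 - x⁻¹ ^ (j + 1)) = -1 * (1 - x ^ (j + 1)) := by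
    rw [mul_sub, ← mul_pow, mul_inv_cancel₀ hx]
    ring
  rw [natDegree_qPochhammer, eval_qPochhammer, eval_qPochhammer, ← Finset.prod_pow_eq_pow_sum,
    ← Finset.prod_mul_distrib, Finset.prod_congr rfl fun j _ => hfactor j,
    Finset.prod_mul_distrib, Finset.prod_const, Finset.card_range]

theorem exists_one_lt_norm_prod_one_sub_pow_eq {d : ℕ} (hd : 2 ≤ d) {b : ℂ} (hb : b ≠ 0) :
    ∃ μ : ℂ, 1 < ‖μ‖ ∧ ∏ j ∈ Finset.range d, (1 - μ ^ (j + 1)) = b := by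
  have hdeg : 0 < (qPochhammer ℂ d).natDegree := by
    rw [natDegree_qPochhammer]
    exact Finset.sum_pos (fun j _ => j.succ_pos) (Finset.nonempty_range_iff.2 (by omega))
  obtain ⟨μ, hμ, hμb⟩ := exists_one_lt_norm_eval_eq hdeg
    (fun x hx => by rw [pow_natDegree_mul_eval_inv_qPochhammer d hx]; simp)
    ((pow_dvd_pow _ hd).trans (X_sub_C_one_pow_dvd_qPochhammer ℂ d)) hb
  exact ⟨μ, hμ, by rw [← eval_qPochhammer, hμb]⟩

theorem exists_mem_Ioo_forall_roots_norm_ne {𝕜 : Type*} [NormedField 𝕜] (P : 𝕜[X]) {s t : ℝ}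
    (hst : s < t) : ∃ ρ ∈ Set.Ioo s t, ∀ a ∈ P.roots, ‖a‖ ≠ ρ := by
  classical
  obtain ⟨ρ, hρ, hne⟩ :=
    (Set.Ioo_infinite hst).exists_notMem_finset (P.roots.toFinset.image fun a => ‖a‖)
  exact ⟨ρ, hρ, fun a ha h => hne (Finset.mem_image.2 ⟨a, Multiset.mem_toFinset.2 ha, h⟩)⟩

section Shift

variable {𝕜 : Type*} [NontriviallyNormedField 𝕜]

/-- The left shift `(v₀, v₁, v₂, …) ↦ (v₁, v₂, v₃, …)` on bounded sequences, which are encoded as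
bounded continuous functions on the discrete space `ℕ`. -/
noncomputable def leftShift : (ℕ →ᵇ 𝕜) →L[𝕜] (ℕ →ᵇ 𝕜) :=
  LinearMap.mkContinuous
    { toFun v := v.compContinuous ⟨Nat.succ, continuous_of_discreteTopology⟩
      map_add' _ _ := rfl
      map_smul' _ _ := rfl }
    1 fun v => by
      rw [one_mul]
      exact v.norm_compContinuous_le _

@[simp]
theorem leftShift_apply (v : ℕ →ᵇ 𝕜) (n : ℕ) : leftShift v n = v (n + 1) := rfl

theorem norm_leftShift_le_one : ‖(leftShift : (ℕ →ᵇ 𝕜) →L[𝕜] (ℕ →ᵇ 𝕜))‖ ≤ 1 :=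
  LinearMap.mkContinuous_norm_le _ zero_le_one _

/-- The right shift `(v₀, v₁, v₂, …) ↦ (0, v₀, v₁, …)` on bounded sequences, a right inverse of
`leftShift`. -/
noncomputable def rightShift : (ℕ →ᵇ 𝕜) →L[𝕜] (ℕ →ᵇ 𝕜) :=
  LinearMap.mkContinuous
    { toFun v := .ofNormedAddCommGroupDiscrete (fun n => n.casesOn 0 v) ‖v‖
        (Nat.rec (by simp) fun n _ => v.norm_coe_le_norm n)
      map_add' u v := by ext (_ | n) <;> simp
      map_smul' c v := by ext (_ | n) <;> simp }
    1 fun v => by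
      rw [one_mul]
      exact (BoundedContinuousFunction.norm_le (norm_nonneg v)).2
        (Nat.rec (by simp) fun n _ => v.norm_coe_le_norm n)

theorem norm_rightShift_le_one : ‖(rightShift : (ℕ →ᵇ 𝕜) →L[𝕜] (ℕ →ᵇ 𝕜))‖ ≤ 1 :=
  LinearMap.mkContinuous_norm_le _ zero_le_one _

theorem leftShift_rightShift (v : ℕ →ᵇ 𝕜) : leftShift (rightShift v) = v := rfl

theorem smul_leftShift_pow_apply (c : 𝕜) (j : ℕ) (v : ℕ →ᵇ 𝕜) (n : ℕ) :
    ((c • leftShift) ^ j) v n = c ^ j * v (n + j) := by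
  induction j generalizing n with
  | zero => simp
  | succ j ih =>
    simp only [pow_succ', mul_apply_eq_comp, smul_apply,
      BoundedContinuousFunction.coe_smul, leftShift_apply, smul_eq_mul, ih]
    rw [mul_assoc, add_right_comm, add_assoc]

theorem surjective_sub_algebraMap_of_norm_lt {E : Type*} [NormedAddCommGroup E] [NormedSpace 𝕜 E]
    [CompleteSpace E] {T : E →L[𝕜] E} {a : 𝕜} (h : ‖T‖ < ‖a‖) :
    Function.Surjective (T - algebraMap 𝕜 (E →L[𝕜] E) a) := by
  have ha : a ∈ resolventSet 𝕜 T := spectrum.mem_resolventSet_of_norm_lt_mul <|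
    (mul_le_of_le_one_right (norm_nonneg T) ContinuousLinearMap.norm_id_le).trans_lt h
  have hunit := (spectrum.mem_resolventSet_iff.1 ha).neg
  rw [neg_sub] at hunit
  exact (ContinuousLinearMap.isUnit_iff_bijective.1 hunit).surjective

theorem surjective_smul_leftShift_sub_algebraMap [CompleteSpace 𝕜] {c a : 𝕜} (h : ‖a‖ ≠ ‖c‖) :
    Function.Surjective (c • leftShift - algebraMap 𝕜 _ a : (ℕ →ᵇ 𝕜) →L[𝕜] (ℕ →ᵇ 𝕜)) := by
  obtain hac | hca := h.lt_or_gt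
  · have hright : ‖a • (rightShift : (ℕ →ᵇ 𝕜) →L[𝕜] (ℕ →ᵇ 𝕜))‖ < ‖c‖ := by
      rw [norm_smul]
      exact (mul_le_of_le_one_right (norm_nonneg a) norm_rightShift_le_one).trans_lt hac
    intro v
    obtain ⟨u, hu⟩ := surjective_sub_algebraMap_of_norm_lt hright (-v)
    refine ⟨rightShift u, ?_⟩
    simpa [Algebra.algebraMap_eq_smul_one, neg_eq_iff_eq_neg, leftShift_rightShift] using
      congrArg Neg.neg hu
  · have hleft : ‖c • (leftShift : (ℕ →ᵇ 𝕜) →L[𝕜] (ℕ →ᵇ 𝕜))‖ < ‖a‖ := by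
      rw [norm_smul]
      exact (mul_le_of_le_one_right (norm_nonneg c) norm_leftShift_le_one).trans_lt hca
    exact surjective_sub_algebraMap_of_norm_lt hleft

theorem surjective_aeval_of_forall_roots {E : Type*} [NormedAddCommGroup E] [NormedSpace 𝕜 E]
    {T : E →L[𝕜] E} {P : 𝕜[X]} (hP : P ≠ 0) (hsplits : P.Splits)
    (h : ∀ a ∈ P.roots, Function.Surjective (T - algebraMap 𝕜 (E →L[𝕜] E) a)) :
    Function.Surjective (aeval T P) := by
  have hlead : Function.Surjective (aeval T (C P.leadingCoeff)) := fun v =>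
    ⟨P.leadingCoeff⁻¹ • v, by
      simp [Algebra.algebraMap_eq_smul_one, smul_smul, hP]⟩
  have hprod : Function.Surjective (aeval T (P.roots.map fun a => X - C a).prod) := by
    refine Multiset.prod_induction (fun q : 𝕜[X] => Function.Surjective (aeval T q)) _ ?_ ?_ ?_
    · intro q₁ q₂ h₁ h₂
      rw [map_mul]
      exact h₁.comp h₂
    · rw [map_one]
      exact Function.surjective_id
    · exact Multiset.forall_mem_map_iff.2 fun a ha => by simpa using h a ha
  rw [hsplits.eq_prod_roots, map_mul]
  exact hlead.comp hprod

/-- The geometric sequence `n ↦ c ^ n` with `‖c‖ ≤ 1`, as a bounded sequence: multiplication by it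
encodes growth and decay rates. -/
def geometricSeq (c : 𝕜) (hc : ‖c‖ ≤ 1) : ℕ →ᵇ 𝕜 :=
  .ofNormedAddCommGroupDiscrete (fun n => c ^ n) 1 fun n => by
    rw [norm_pow]
    exact pow_le_one₀ (norm_nonneg c) hc

@[simp]
theorem geometricSeq_apply (c : 𝕜) (hc : ‖c‖ ≤ 1) (n : ℕ) : geometricSeq c hc n = c ^ n := rfl

end Shift

section Perturbation

variable {𝕜 : Type*} [NontriviallyNormedField 𝕜]

theorem exists_ne_zero_eq_smul_of_surjective {E F : Type*}
    [NormedAddCommGroup E] [NormedSpace 𝕜 E] [CompleteSpace E]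
    [NormedAddCommGroup F] [NormedSpace 𝕜 F] [CompleteSpace F] [CompleteSpace 𝕜]
    {Φ : E → F} {Φ' : E →L[𝕜] F} (hΦ : HasStrictFDerivAt Φ Φ' 0) (hΦ0 : Φ 0 = 0)
    (hsurj : Function.Surjective Φ') {k : 𝕜 × E → F} {k' : 𝕜 × E →L[𝕜] F}
    (hk : HasStrictFDerivAt k k' 0) {δ : ℝ} (hδ : 0 < δ) :
    ∃ ε : 𝕜, ε ≠ 0 ∧ ∃ v : E, ‖v‖ < δ ∧ Φ v = ε • k (ε, v) := by
  let Ψ : 𝕜 × E → 𝕜 × F := fun x => (x.1, Φ x.2 - x.1 • k x)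
  have hΨ : HasStrictFDerivAt Ψ ((ContinuousLinearMap.fst 𝕜 𝕜 E).prod
      (Φ'.comp (.snd 𝕜 𝕜 E) - (ContinuousLinearMap.fst 𝕜 𝕜 E).smulRight (k 0))) 0 := by
    have hsnd : HasStrictFDerivAt (fun x : 𝕜 × E => Φ x.2) (Φ'.comp (.snd 𝕜 𝕜 E)) 0 :=
      HasStrictFDerivAt.comp (g := Φ) (f := Prod.snd) 0 hΦ hasStrictFDerivAt_snd
    refine hasStrictFDerivAt_fst.prodMk (hsnd.sub ?_)
    refine (hasStrictFDerivAt_fst.smul hk).congr_fderiv ?_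
    simp
  have hrange : ((ContinuousLinearMap.fst 𝕜 𝕜 E).prod
      (Φ'.comp (.snd 𝕜 𝕜 E) - (ContinuousLinearMap.fst 𝕜 𝕜 E).smulRight (k 0))).range = ⊤ := by
    refine LinearMap.range_eq_top.2 fun ⟨c, b⟩ => ?_
    obtain ⟨v, hv⟩ := hsurj (b + c • k 0)
    exact ⟨(c, v), by simp [hv]⟩
  have hΨ0 : Ψ 0 = 0 := by simp [Ψ, hΦ0]
  have hball : Ψ '' Metric.ball 0 δ ∈ 𝓝 (0 : 𝕜 × F) := by
    rw [← hΨ0, ← hΨ.map_nhds_eq_of_surj hrange]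
    exact image_mem_map (Metric.ball_mem_nhds _ hδ)
  have hev : ∀ᶠ ε : 𝕜 in 𝓝[≠] 0, (ε, (0 : F)) ∈ Ψ '' Metric.ball 0 δ :=
    ((Continuous.prodMk_left (0 : F)).tendsto 0 |>.eventually_mem hball).filter_mono
      nhdsWithin_le_nhds
  obtain ⟨ε, ⟨⟨c, v⟩, hx, hxε⟩, hε⟩ := (hev.and self_mem_nhdsWithin).exists
  obtain ⟨rfl, hv⟩ := Prod.mk.inj hxε
  exact ⟨c, hε, v, (norm_snd_le _).trans_lt (mem_ball_zero_iff.1 hx), sub_eq_zero.1 hv⟩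

variable {A : Type*} [NormedCommRing A] [NormedAlgebra 𝕜 A]

theorem exists_hasStrictFDerivAt_prod_one_add_mul {ι : Type*}
    (r : A) (w : ι → A →L[𝕜] A) (s : Finset ι) :
    ∃ g : A → A, g 0 = 0 ∧ HasStrictFDerivAt g (∑ j ∈ s, w j) 0 ∧
      ∀ v, ∏ j ∈ s, (1 + r * w j v) = 1 + r * g v := by
  classical
  induction s using Finset.induction_on with
  | empty => exact ⟨fun _ => 0, rfl, by simpa using hasStrictFDerivAt_const 0 0, by simp⟩
  | insert a s ha ih =>
    obtain ⟨g, hg0, hg, hprod⟩ := ih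
    refine ⟨fun v => w a v + g v + r * (w a v * g v), by simp [hg0], ?_, fun v => ?_⟩
    · rw [Finset.sum_insert ha]
      refine (((w a).hasStrictFDerivAt.add hg).add
        (((w a).hasStrictFDerivAt.mul hg).const_mul r)).congr_fderiv ?_
      simp [hg0]
    · rw [Finset.prod_insert ha, hprod]
      ring

-- Both sides of the equation are `1` modulo `r`. It is solved after removing the factor `r`, which
-- need not be invertible: for a decaying sequence `r` its inverse would be unbounded.
theorem exists_prod_one_add_mul_eq_pow_add_smul [CompleteSpace 𝕜] [CompleteSpace A] {ι : Type*}
    (r : A) {w : ι → A →L[𝕜] A} {s : Finset ι}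
    (hsurj : Function.Surjective (∑ j ∈ s, w j - algebraMap 𝕜 (A →L[𝕜] A) s.card))
    {k : 𝕜 × A → A} {k' : 𝕜 × A →L[𝕜] A} (hk : HasStrictFDerivAt k k' 0) {δ : ℝ} (hδ : 0 < δ) :
    ∃ ε : 𝕜, ε ≠ 0 ∧ ∃ v : A, ‖v‖ < δ ∧
      ∏ j ∈ s, (1 + r * w j v) = (1 + r * v) ^ s.card + ε • (r * k (ε, v)) := by
  obtain ⟨g, hg0, hg, hprod⟩ := exists_hasStrictFDerivAt_prod_one_add_mul r w s
  obtain ⟨f, hf0, hf, hpow⟩ :=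
    exists_hasStrictFDerivAt_prod_one_add_mul r (fun _ => (1 : A →L[𝕜] A)) s
  have hlin : ∑ _j ∈ s, (1 : A →L[𝕜] A) = algebraMap 𝕜 (A →L[𝕜] A) s.card := by simp
  rw [← hlin] at hsurj
  obtain ⟨ε, hε, v, hv, hgf⟩ :=
    exists_ne_zero_eq_smul_of_surjective (hg.sub hf) (by simp [hg0, hf0]) hsurj hk hδ
  refine ⟨ε, hε, v, hv, ?_⟩
  have hpow_v : (1 + r * v) ^ s.card = 1 + r * f v := by simpa using hpow v
  have hgf_v : g v - f v = ε • k (ε, v) := hgf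
  rw [hprod, hpow_v, ← mul_smul_comm, ← hgf_v]
  ring

theorem exists_prod_one_add_mul_eq_pow_add_sum [CompleteSpace 𝕜] [CompleteSpace A] {d : ℕ}
    (a : ℕ → 𝕜) (r e : A) {w : ℕ → A →L[𝕜] A}
    (hsurj : Function.Surjective (∑ j ∈ Finset.range d, w j - algebraMap 𝕜 (A →L[𝕜] A) d))
    {δ : ℝ} (hδ : 0 < δ) :
    ∃ ε : 𝕜, ε ≠ 0 ∧ ∃ v : A, ‖v‖ < δ ∧ ∏ j ∈ Finset.range d, (1 + r * w j v) =
      (1 + r * v) ^ d +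
        ∑ i ∈ Finset.range d, (a i * ε ^ (d - i)) • ((r * e) ^ (d - i) * (1 + r * v) ^ i) := by
  let k : 𝕜 × A → A := fun x => ∑ i ∈ Finset.range d,
    (a i * x.1 ^ (d - i - 1)) • (e * (r * e) ^ (d - i - 1) * (1 + r * x.2) ^ i)
  have hk : AnalyticAt 𝕜 k 0 := Finset.analyticAt_fun_sum _ fun i _ =>
    (analyticAt_const.mul (analyticAt_fst.pow _)).smul
      (analyticAt_const.mul ((analyticAt_const.add (analyticAt_const.mul analyticAt_snd)).pow _))
  obtain ⟨ε, hε, v, hv, hprod⟩ := exists_prod_one_add_mul_eq_pow_add_smul r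
    (s := Finset.range d) (by rwa [Finset.card_range]) hk.hasStrictFDerivAt hδ
  refine ⟨ε, hε, v, hv, ?_⟩
  rw [hprod, Finset.card_range, Finset.mul_sum, Finset.smul_sum]
  congr 1
  refine Finset.sum_congr rfl fun i hi => ?_
  obtain ⟨m, hm⟩ := Nat.exists_eq_add_of_lt (Finset.mem_range.1 hi)
  rw [show d - i = m + 1 by omega, Nat.add_sub_cancel, mul_smul_comm, smul_smul]
  congr 1 <;> ring

end Perturbation

/-- The polynomial whose value at the left shift, applied to `u`, is the relative change of
`y_k - y_{k + j + 1}` when the solution `y_k = μ ^ k` is modified to `y_k = μ ^ k (1 + u_k)`. -/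
noncomputable def linearizedFactor {K : Type*} [Field K] (μ : K) (j : ℕ) : K[X] :=
  C (1 - μ ^ (j + 1))⁻¹ * (1 - C (μ ^ (j + 1)) * X ^ (j + 1))

/-- The characteristic polynomial of the linearization of
`∏_{j = 1}^d (y_k - y_{k + j}) = b y_k ^ d` along the solution `y_k = μ ^ k`, where
`b = ∏_{j = 1}^d (1 - μ ^ j)`. -/
noncomputable def characteristicPoly {K : Type*} [Field K] (d : ℕ) (μ : K) : K[X] :=
  ∑ j ∈ Finset.range d, linearizedFactor μ j - C (d : K)

theorem characteristicPoly_succ_ne_zero {K : Type*} [Field K] {d : ℕ} {μ : K} (hμ : μ ≠ 0)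
    (hμd : 1 - μ ^ (d + 1) ≠ 0) : characteristicPoly (d + 1) μ ≠ 0 := by
  have hcoeff (j : ℕ) : (linearizedFactor μ j).coeff (d + 1) =
      -if d = j then (1 - μ ^ (j + 1))⁻¹ * μ ^ (j + 1) else 0 := by
    rw [linearizedFactor, coeff_C_mul, coeff_sub, coeff_C_mul_X_pow]
    simp [coeff_one]
  have hlead : (characteristicPoly (d + 1) μ).coeff (d + 1) =
      -((1 - μ ^ (d + 1))⁻¹ * μ ^ (d + 1)) := by
    simp [characteristicPoly, finsetSum_coeff, hcoeff, coeff_C_succ, -map_add, -map_natCast]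
  intro h
  rw [h, coeff_zero, eq_comm, neg_eq_zero] at hlead
  exact mul_ne_zero (inv_ne_zero hμd) (pow_ne_zero _ hμ) hlead

theorem aeval_smul_leftShift_linearizedFactor_apply {𝕜 : Type*} [NontriviallyNormedField 𝕜]
    (c μ : 𝕜) (j : ℕ) (v : ℕ →ᵇ 𝕜) (n : ℕ) :
    aeval (c • leftShift) (linearizedFactor μ j) v n =
      (1 - μ ^ (j + 1))⁻¹ * (v n - μ ^ (j + 1) * (c ^ (j + 1) * v (n + (j + 1)))) := by
  rw [linearizedFactor, map_mul, map_sub, map_mul, aeval_X_pow, aeval_C, aeval_C, map_one,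
    Algebra.algebraMap_eq_smul_one, Algebra.algebraMap_eq_smul_one, ← smul_leftShift_pow_apply]
  rfl

theorem exists_mem_Ioo_surjective_aeval_smul_leftShift {P : ℂ[X]} (hP : P ≠ 0) {s t : ℝ}
    (hs : 0 ≤ s) (hst : s < t) :
    ∃ ρ ∈ Set.Ioo s t, Function.Surjective
      (aeval ((ρ : ℂ) • (leftShift : (ℕ →ᵇ ℂ) →L[ℂ] (ℕ →ᵇ ℂ))) P) := by
  obtain ⟨ρ, hρ, hroots⟩ := exists_mem_Ioo_forall_roots_norm_ne P hst
  refine ⟨ρ, hρ, surjective_aeval_of_forall_roots hP (IsAlgClosed.splits P) fun a ha =>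
    surjective_smul_leftShift_sub_algebraMap ?_⟩
  rw [Complex.norm_of_nonneg (hs.trans hρ.1.le)]
  exact hroots a ha

theorem one_sub_pow_succ_ne_zero_of_one_lt_norm {𝕜 : Type*} [NormedField 𝕜] {μ : 𝕜}
    (hμ : 1 < ‖μ‖) (j : ℕ) : 1 - μ ^ (j + 1) ≠ 0 := fun h => by
  have hpow := one_lt_pow₀ hμ j.succ_ne_zero
  rw [← norm_pow, ← sub_eq_zero.1 h, norm_one] at hpow
  exact lt_irrefl _ hpow

theorem exists_perturbed_geometric_solution {d : ℕ} (hd : d ≠ 0) {μ : ℂ} (hμ : 1 < ‖μ‖)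
    (a : ℕ → ℂ) {δ : ℝ} (hδ : 0 < δ) :
    ∃ ε : ℂ, ε ≠ 0 ∧ ∃ u : ℕ → ℂ, (∀ n, ‖u n‖ < δ) ∧ ∀ n,
      ∏ j ∈ Finset.range d, (1 + (1 - μ ^ (j + 1))⁻¹ * (u n - μ ^ (j + 1) * u (n + (j + 1)))) =
        (1 + u n) ^ d + ∑ i ∈ Finset.range d, a i * (ε / μ ^ n) ^ (d - i) * (1 + u n) ^ i := by
  have hμ0 : 0 < ‖μ‖ := one_pos.trans hμ
  obtain ⟨m, rfl⟩ := Nat.exists_eq_succ_of_ne_zero hd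
  obtain ⟨ρ, ⟨hμρ, hρ1⟩, hsurj⟩ := exists_mem_Ioo_surjective_aeval_smul_leftShift
    (characteristicPoly_succ_ne_zero (norm_pos_iff.1 hμ0)
      (one_sub_pow_succ_ne_zero_of_one_lt_norm hμ m))
    (inv_nonneg.2 hμ0.le) (inv_lt_one_of_one_lt₀ hμ)
  have hρ0 : 0 < ρ := (inv_pos.2 hμ0).trans hμρ
  have hρ : ‖(ρ : ℂ)‖ = ρ := Complex.norm_of_nonneg hρ0.le
  have hμρ1 : ‖(μ * ρ)⁻¹‖ ≤ 1 := by
    rw [norm_inv, norm_mul, hρ]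
    exact inv_le_one_of_one_le₀ ((inv_lt_iff_one_lt_mul₀' hμ0).1 hμρ).le
  have hgeom (n : ℕ) : (ρ : ℂ) ^ n * ((μ * ρ)⁻¹) ^ n = (μ ^ n)⁻¹ := by
    have : (ρ : ℂ) ≠ 0 := by exact_mod_cast hρ0.ne'
    rw [← mul_pow, mul_inv, mul_left_comm, mul_inv_cancel₀ this, mul_one, inv_pow]
  rw [characteristicPoly, map_sub, map_sum, aeval_C] at hsurj
  -- The coefficients `a i` enter with powers of `μ⁻ⁿ = ρⁿ (μ ρ)⁻ⁿ`, and `(μ ρ)⁻ⁿ` is bounded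
  -- because `|μ|⁻¹ < ρ`.
  obtain ⟨ε, hε, v, hv, hprod⟩ := exists_prod_one_add_mul_eq_pow_add_sum a
    (geometricSeq (ρ : ℂ) (hρ.trans_le hρ1.le)) (geometricSeq (μ * ρ)⁻¹ hμρ1) hsurj hδ
  refine ⟨ε, hε, fun n => ρ ^ n * v n, fun n => ?_, fun n => ?_⟩
  · rw [norm_mul, norm_pow, hρ]
    exact (mul_le_of_le_one_left (norm_nonneg _) (pow_le_one₀ hρ0.le hρ1.le)).trans_lt
      ((v.norm_coe_le_norm n).trans_lt hv)
  · have hn := DFunLike.congr_fun hprod n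
    simp only [BoundedContinuousFunction.coe_prod, Finset.prod_apply,
      BoundedContinuousFunction.coe_add, BoundedContinuousFunction.coe_sum, Finset.sum_apply,
      BoundedContinuousFunction.coe_mul, BoundedContinuousFunction.coe_one, Pi.add_apply,
      Pi.mul_apply, Pi.one_apply, BoundedContinuousFunction.coe_pow, Pi.pow_apply,
      BoundedContinuousFunction.coe_smul, smul_eq_mul, geometricSeq_apply, hgeom,
      aeval_smul_leftShift_linearizedFactor_apply] at hn
    convert hn using 3 <;> ring

/-- The recurrence satisfied by the list `y` of all values that the `d` coordinates take
successively: the coordinate with value `y k` is replaced by `y (k + d)` while the other coordinates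
have the values `y (k + 1), …, y (k + d - 1)`. The Weierstrass update is written with its
denominator cleared. -/
def IsGSWRecurrence (d : ℕ) (p : ℂ[X]) (y : ℕ → ℂ) : Prop :=
  ∀ k, ∏ j ∈ Finset.range d, (y k - y (k + (j + 1))) = p.eval (y k)

theorem prod_mul_pow_mul_one_add_sub {K : Type*} [Field K] {d : ℕ} {μ : K}
    (hμ : ∀ j ∈ Finset.range d, 1 - μ ^ (j + 1) ≠ 0) (c : K) (u : ℕ → K) (n : ℕ) :
    ∏ j ∈ Finset.range d, (c * μ ^ n * (1 + u n) -
        c * μ ^ (n + (j + 1)) * (1 + u (n + (j + 1)))) =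
      (c * μ ^ n) ^ d * (∏ j ∈ Finset.range d, (1 - μ ^ (j + 1))) *
        ∏ j ∈ Finset.range d,
          (1 + (1 - μ ^ (j + 1))⁻¹ * (u n - μ ^ (j + 1) * u (n + (j + 1)))) := by
  have hfactor : ∀ j ∈ Finset.range d,
      c * μ ^ n * (1 + u n) - c * μ ^ (n + (j + 1)) * (1 + u (n + (j + 1))) =
      c * μ ^ n * (1 - μ ^ (j + 1)) *
        (1 + (1 - μ ^ (j + 1))⁻¹ * (u n - μ ^ (j + 1) * u (n + (j + 1)))) := fun j hj => by
    rw [mul_assoc _ (1 - _), mul_add (1 - _), mul_inv_cancel_left₀ (hμ j hj), pow_add]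
    ring
  rw [Finset.prod_congr rfl hfactor, Finset.prod_mul_distrib,
    Finset.prod_mul_distrib, Finset.prod_const, Finset.card_range]

theorem eval_inv_mul_eq_leadingCoeff_mul {K : Type*} [Field K] {p : K[X]} (hp : p ≠ 0) {t : K}
    (ht : t ≠ 0) (x : K) :
    p.eval (t⁻¹ * x) = t⁻¹ ^ p.natDegree * p.leadingCoeff * (x ^ p.natDegree +
      ∑ i ∈ Finset.range p.natDegree,
        p.coeff i / p.leadingCoeff * t ^ (p.natDegree - i) * x ^ i) := by
  have hlead : p.leadingCoeff ≠ 0 := leadingCoeff_ne_zero.2 hp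
  have hscale := scaleRoots_eval_mul p (t⁻¹ * x) t
  rw [mul_inv_cancel_left₀ ht, eval_eq_sum_range, natDegree_scaleRoots,
    Finset.sum_range_succ_comm] at hscale
  simp only [coeff_scaleRoots, coeff_natDegree, Nat.sub_self, pow_zero, mul_one] at hscale
  rw [inv_pow, mul_assoc, eq_inv_mul_iff_mul_eq₀ (pow_ne_zero _ ht), ← hscale, mul_add,
    Finset.mul_sum]
  congr 1
  refine Finset.sum_congr rfl fun i _ => ?_
  rw [← mul_assoc, ← mul_assoc, mul_div_cancel₀ _ hlead]

theorem tendsto_norm_mul_pow_mul_one_add_atTop {𝕜 : Type*} [NormedField 𝕜] {c μ : 𝕜} (hc : c ≠ 0)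
    (hμ : 1 < ‖μ‖) {u : ℕ → 𝕜} {δ : ℝ} (hδ : δ < 1) (hu : ∀ n, ‖u n‖ ≤ δ) :
    Tendsto (fun n => ‖c * μ ^ n * (1 + u n)‖) atTop atTop := by
  have hgrowth : Tendsto (fun n : ℕ => ‖c‖ * (1 - δ) * ‖μ‖ ^ n) atTop atTop :=
    (tendsto_pow_atTop_atTop_of_one_lt hμ).const_mul_atTop
      (mul_pos (norm_pos_iff.2 hc) (sub_pos.2 hδ))
  refine tendsto_atTop_mono (fun n => ?_) hgrowth
  have hone : 1 - δ ≤ ‖1 + u n‖ := by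
    have := norm_sub_le_norm_add (1 : 𝕜) (u n)
    rw [norm_one] at this
    linarith [hu n]
  rw [norm_mul, norm_mul, norm_pow, mul_right_comm]
  gcongr

theorem exists_isGSWRecurrence_tendsto_norm_atTop {p : ℂ[X]} (hp : 2 ≤ p.natDegree) :
    ∃ y : ℕ → ℂ, IsGSWRecurrence p.natDegree p y ∧ Tendsto (fun k => ‖y k‖) atTop atTop := by
  have hp0 : p ≠ 0 := ne_zero_of_natDegree_gt (n := 1) hp
  obtain ⟨μ, hμ, hlead⟩ :=
    exists_one_lt_norm_prod_one_sub_pow_eq hp (leadingCoeff_ne_zero.2 hp0)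
  have hμ0 : μ ≠ 0 := norm_pos_iff.1 (one_pos.trans hμ)
  obtain ⟨ε, hε, u, hu, hprod⟩ := exists_perturbed_geometric_solution (d := p.natDegree) (by omega)
    hμ (fun i => p.coeff i / p.leadingCoeff) one_half_pos
  refine ⟨fun n => ε⁻¹ * μ ^ n * (1 + u n), fun n => ?_,
    tendsto_norm_mul_pow_mul_one_add_atTop (inv_ne_zero hε) hμ one_half_lt_one
      fun n => (hu n).le⟩
  have hscale : ε⁻¹ * μ ^ n = (ε / μ ^ n)⁻¹ := by rw [inv_div, div_eq_inv_mul]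
  beta_reduce
  rw [prod_mul_pow_mul_one_add_sub fun j _ => one_sub_pow_succ_ne_zero_of_one_lt_norm hμ j,
    hlead, hprod, hscale, eval_inv_mul_eq_leadingCoeff_mul hp0 (div_ne_zero hε (pow_ne_zero n hμ0))]

section Orbit

variable {d : ℕ} {p : ℂ[X]} {y : ℕ → ℂ}

theorem prod_erase_sub_ite_eq_prod_range (y : ℕ → ℂ) (n : ℕ) (i : Fin d) :
    ∏ j ∈ Finset.univ.erase i,
        (y (n + i) - if (j : ℕ) < i then y (n + d + j) else y (n + j)) =
      ∏ l ∈ Finset.range (d - 1), (y (n + i) - y (n + i + (l + 1))) := by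
  refine Finset.prod_nbij (fun j => if (j : ℕ) < i then d - i + j - 1 else j - i - 1) ?_ ?_ ?_ ?_
  · intro j hj
    have hne : (j : ℕ) ≠ i := Fin.val_ne_of_ne (Finset.ne_of_mem_erase hj)
    grind
  · intro j hj k hk hjk
    have hj : (j : ℕ) ≠ i := Fin.val_ne_of_ne (Finset.ne_of_mem_erase hj)
    have hk : (k : ℕ) ≠ i := Fin.val_ne_of_ne (Finset.ne_of_mem_erase hk)
    grind
  · intro l hl
    have hl := Finset.mem_range.1 hl
    obtain hlt | hge := lt_or_ge (i + (l + 1)) d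
    · exact ⟨⟨i + (l + 1), hlt⟩, by simp [Fin.ext_iff], by grind⟩
    · exact ⟨⟨i + (l + 1) - d, by omega⟩, by simpa [Fin.ext_iff] using by omega, by grind⟩
  · intro j _
    split_ifs with h <;> grind

theorem IsGSWRecurrence.add_left (hy : IsGSWRecurrence d p y) (K : ℕ) :
    IsGSWRecurrence d p fun k => y (K + k) := fun k => by
  simpa only [add_assoc] using hy (K + k)

theorem IsGSWRecurrence.prod_pred_ne_zero (hy : IsGSWRecurrence d p y) {k : ℕ}
    (hk : p.eval (y k) ≠ 0) :
    ∏ j ∈ Finset.range (d - 1), (y k - y (k + (j + 1))) ≠ 0 := by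
  rw [← hy k, Finset.prod_ne_zero_iff] at hk
  exact Finset.prod_ne_zero_iff.2 fun j hj =>
    hk j (Finset.range_mono (Nat.sub_le d 1) hj)

theorem IsGSWRecurrence.sub_eval_div_prod_pred (hy : IsGSWRecurrence d p y) (hd : d ≠ 0) {k : ℕ}
    (hk : p.eval (y k) ≠ 0) :
    y k - p.eval (y k) / ∏ j ∈ Finset.range (d - 1), (y k - y (k + (j + 1))) = y (k + d) := by
  have hprod := hy.prod_pred_ne_zero hk
  obtain ⟨m, rfl⟩ := Nat.exists_eq_succ_of_ne_zero hd
  rw [← hy k, Finset.prod_range_succ]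
  exact (congrArg _ (mul_div_cancel_left₀ _ hprod)).trans (sub_sub_cancel _ _)

theorem IsGSWRecurrence.gswPartial_apply (hy : IsGSWRecurrence d p y)
    (hp : ∀ k, p.eval (y k) ≠ 0) (n : ℕ) {k : ℕ} (hk : k ≤ d) (i : Fin d) :
    gswPartial p (fun i : Fin d => y (n + i)) k i =
      if (i : ℕ) < k then y (n + d + i) else y (n + i) := by
  induction k generalizing i with
  | zero => simp [gswPartial]
  | succ k ih =>
    have hkd : k < d := hk
    rw [gswPartial, dif_pos hkd]
    obtain rfl | hik := eq_or_ne i ⟨k, hkd⟩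
    · have hprod := prod_erase_sub_ite_eq_prod_range y n ⟨k, hkd⟩
      rw [Function.update_self, if_pos k.lt_succ_self, weierstrassUpdate]
      simp only [ih hkd.le, lt_self_iff_false, if_false] at hprod ⊢
      rw [hprod, hy.sub_eval_div_prod_pred (Nat.ne_zero_of_lt hkd) (hp _), add_right_comm]
    · have hik' : (i : ℕ) ≠ k := fun h => hik (Fin.ext h)
      rw [Function.update_of_ne hik, ih hkd.le]
      exact if_congr (by omega) rfl rfl

theorem IsGSWRecurrence.isGSWOrbit (hy : IsGSWRecurrence d p y) (hp : ∀ k, p.eval (y k) ≠ 0) :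
    IsGSWOrbit p fun m (i : Fin d) => y (m * d + i) := by
  refine fun m => ⟨fun i => ?_, funext fun i => ?_⟩
  · simp only [hy.gswPartial_apply hp (m * d) i.2.le, lt_self_iff_false, if_false]
    rw [prod_erase_sub_ite_eq_prod_range]
    exact hy.prod_pred_ne_zero (hp _)
  · rw [GSW, hy.gswPartial_apply hp (m * d) le_rfl, if_pos i.2, ← Nat.succ_mul]

end Orbit

theorem theorem2_general {p : ℂ[X]} (hp : 2 ≤ p.natDegree) :
    ∃ z : ℕ → Fin p.natDegree → ℂ, IsGSWOrbit p z ∧ Tendsto (fun m => ‖z m‖) atTop atTop := by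
  obtain ⟨y, hy, hlim⟩ := exists_isGSWRecurrence_tendsto_norm_atTop hp
  have heval : Tendsto (fun k => ‖p.eval (y k)‖) atTop atTop :=
    p.tendsto_norm_atTop (natDegree_pos_iff_degree_pos.1 (by omega)) hlim
  obtain ⟨K, hK⟩ := eventually_atTop.1 (heval.eventually_gt_atTop 0)
  refine ⟨fun m i => y (K + (m * p.natDegree + i)),
    (hy.add_left K).isGSWOrbit fun k => norm_pos_iff.1 (hK _ (Nat.le_add_right K k)), ?_⟩
  have hindex : StrictMono fun m => K + m * p.natDegree := fun m n hmn =>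
    Nat.add_lt_add_left (Nat.mul_lt_mul_of_pos_right hmn (by omega)) K
  exact tendsto_atTop_mono
    (fun m => norm_le_pi_norm (fun i : Fin p.natDegree => y (K + (m * p.natDegree + i)))
      ⟨0, by omega⟩) (hlim.comp hindex.tendsto_atTop)

theorem theorem2 (d : ℕ) (hd : 3 ≤ d) (p : ℂ[X]) (hmonic : p.Monic)
    (hdeg : p.natDegree = d) (hroots : p.roots.Nodup) :
    ∃ z : ℕ → Fin d → ℂ, IsGSWOrbit p z ∧ Tendsto (fun m => ‖z m‖) atTop atTop := by
  subst hdeg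
  exact theorem2_general (by omega)
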